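/- Let $x_+:=\max(0,x)$, and let $Z$ be a standard normal random variable. Let $X_1,\dots,X_n$ be independent real random variables with $\sum_i\mathbb E X_i^2\le 1$, and let $S:=X_1+\dots+X_n$. All expectations of nonnegative variables below are taken in $[0,\infty]$. (i) If $\mathbb E X_i\le 0$ for all $i$ and $\sum_i\mathbb E (X_i)_+^3\le\beta$ for some real $\beta>0$, then for every real $x$ $$\mathbb E(S-x)_+^3\le \mathbb E(Z-x)_+^3+\beta .$$ (ii) If $\mathbb E X_i=0$ for all $i$, then for every real $x$ $$\mathbb E|S-x|^3\le \mathbb E|Z-x|^3+\sum_i\mathbb E|X_i|^3 .$$ (iii) The bound in (ii) is exact for each real $x$: for every real $x$ and every real $B>0$, the number $\mathbb E|Z-x|^3+B$ is the supremum of $\mathbb E|S-x|^3$ over all $n$ and all independent zero-mean random variables $X_1,\dots,X_n$ (on arbitrary probability spaces) with $\sum_i\mathbb E X_i^2\le1$ and $\sum_i\mathbb E|X_i|^3=B$. -/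

import Mathlib

open MeasureTheory ProbabilityTheory
open scoped ENNReal

/-- Expectation, with values in `[0, ∞]`, of a nonnegative real random variable `Y`. -/
noncomputable def expNN {Ω : Type*} [MeasurableSpace Ω] (P : Measure Ω) (Y : Ω → ℝ) : ℝ≥0∞ :=
  ∫⁻ ω, ENNReal.ofReal (Y ω) ∂P

/-- `X 0, …, X (n - 1)` are independent real random variables on `(Ω, P)` whose second moments
sum to at most `1`. In particular every `X i` is integrable when `P` is a probability measure. -/
structure IndepUnitVariance {Ω : Type*} [MeasurableSpace Ω] (P : Measure Ω) {n : ℕ}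
    (X : Fin n → Ω → ℝ) : Prop where
  measurable : ∀ i, Measurable (X i)
  indep : iIndepFun X P
  sum_sq_le : ∑ i, expNN P (fun ω => X i ω ^ 2) ≤ 1

/-- The set of all values of `E|S - x|^3`, where `S = X 0 + … + X (n - 1)`, over all `n`, all
probability spaces, and all independent zero-mean `X i` with `∑ E (X i)^2 ≤ 1` and
`∑ E|X i|^3 = B`. -/
def absThirdMomentValues (x B : ℝ) : Set ℝ≥0∞ :=
  {m | ∃ (n : ℕ) (Ω : Type) (_ : MeasurableSpace Ω) (P : Measure Ω) (_ : IsProbabilityMeasure P)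
    (X : Fin n → Ω → ℝ),
    IndepUnitVariance P X ∧ (∀ i, ∫ ω, X i ω ∂P = 0) ∧
    ∑ i, expNN P (fun ω => |X i ω| ^ 3) = ENNReal.ofReal B ∧
    m = expNN P (fun ω => |(∑ i, X i ω) - x| ^ 3)}

/-!
The upper bounds are obtained by Lindeberg replacement: the summands are exchanged one at a time for
independent centred Gaussians of the same second moment. For the functions `(· - x)_+^3` each
exchange is controlled by an elementary pointwise inequality: for `a ≥ 0`,
`(t + a)_+^3 ≤ t_+^3 + 3at^2 + 3a^2t + a^3`, whereas for `a ≤ 0` the left side is at most `t_+^3`.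
If `E T ≤ 0` and `E T^2 ≤ v`, the expected polynomial is at most `3va + a^3`, which is the third
moment of `N(0, v) + a` and hence at most `E(N(0, v) + a)_+^3`. Thus one exchange costs at most
`E T_+^3` for every shift `a` (`lintegral_posPart_cube_add_le`), and the costs add up over the
summands (`lintegral_posPart_cube_sum_le`). The same inequality with `T = 0` fills the total
variance up to `1`. The bound for `|S - x|^3` follows by applying the one-sided bound to the `X i`
and to their negatives.

For exactness, `k^2` Gaussian summands of standard deviation `s / k` are combined with one
symmetric jump to `± k` of probability of order `k^{-3}`. The third absolute moments of the
Gaussian summands add up to `O(1 / k)`, so nearly all of `B` is left to the jump, whose variance is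
only `O(1 / k)`, so that `s` may tend to `1`. By convexity of `|·|^3` the jump contributes its full
third absolute moment to `E|S - x|^3`, on top of the Gaussian part
(`exists_mem_absThirdMomentValues_ge`).
-/

open scoped NNReal Topology
open Filter

/-! ### Convolutions and Gaussian laws -/

lemma map_sum_univ_succ_eq_conv {Ω : Type*} [MeasurableSpace Ω] {P : Measure Ω}
    [IsProbabilityMeasure P] {n : ℕ} {X : Fin (n + 1) → Ω → ℝ} (hm : ∀ i, Measurable (X i))
    (hX : iIndepFun X P) :
    P.map (fun ω => ∑ i, X i ω) =
      (P.map (fun ω => ∑ i : Fin n, X i.castSucc ω)) ∗ P.map (X (Fin.last n)) := by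
  have hs : Fin.last n ∉ Finset.univ.map (Fin.castSuccEmb (n := n)) := by
    simp [Fin.castSucc_ne_last]
  have h := hX.indepFun_finsetSum_of_notMem hm hs
  rw [Finset.sum_map] at h
  have hsum : (fun ω => ∑ i, X i ω) =
      (∑ i : Fin n, X (Fin.castSuccEmb i)) + X (Fin.last n) := by
    ext ω
    simp [Fin.sum_univ_castSucc]
  have hsum' : (fun ω => ∑ i : Fin n, X i.castSucc ω) = ∑ i : Fin n, X (Fin.castSuccEmb i) := by
    ext ω
    simp
  rw [hsum, hsum']
  exact h.map_add_eq_map_conv_map (hsum' ▸ Finset.measurable_fun_sum _ fun i _ => hm _) (hm _)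

lemma lintegral_gaussianReal_neg (v : ℝ≥0) {f : ℝ → ℝ≥0∞} (hf : Measurable f) :
    ∫⁻ z, f (-z) ∂gaussianReal 0 v = ∫⁻ z, f z ∂gaussianReal 0 v := by
  conv_rhs => rw [← neg_zero, ← gaussianReal_map_neg, lintegral_map hf measurable_neg]

lemma two_mul_lintegral_gaussianReal (v : ℝ≥0) {f : ℝ → ℝ≥0∞} (hf : Measurable f) :
    2 * ∫⁻ z, f z ∂gaussianReal 0 v = ∫⁻ z, (f z + f (-z)) ∂gaussianReal 0 v := by
  rw [lintegral_add_left hf, lintegral_gaussianReal_neg v hf, two_mul]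

lemma lintegral_gaussianReal_sq (σ : ℝ≥0) {f : ℝ → ℝ≥0∞} (hf : Measurable f) :
    ∫⁻ z, f z ∂gaussianReal 0 (σ ^ 2) = ∫⁻ z, f (σ * z) ∂gaussianReal 0 1 := by
  rw [← lintegral_map hf (measurable_const_mul (σ : ℝ)), gaussianReal_map_const_mul]
  congr 2
  · simp
  · ext; simp

lemma integral_sq_gaussianReal (v : ℝ≥0) : ∫ z, z ^ 2 ∂gaussianReal 0 v = v := by
  have h := variance_fun_id_gaussianReal (μ := 0) (v := v)
  rw [variance_eq_integral (by fun_prop)] at h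
  simpa using h

lemma integrable_sq_gaussianReal (v : ℝ≥0) :
    Integrable (fun z : ℝ => z ^ 2) (gaussianReal 0 v) :=
  (memLp_id_gaussianReal 2).integrable_sq

lemma lintegral_sq_gaussianReal (v : ℝ≥0) :
    ∫⁻ z, ENNReal.ofReal (z ^ 2) ∂gaussianReal 0 v = v := by
  rw [← ofReal_integral_eq_lintegral_ofReal (integrable_sq_gaussianReal v)
    (ae_of_all _ fun z => sq_nonneg z), integral_sq_gaussianReal, ENNReal.ofReal_coe_nnreal]

lemma lintegral_abs_pow_three_gaussianReal_ne_top :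
    ∫⁻ z, ENNReal.ofReal (|z| ^ 3) ∂gaussianReal 0 1 ≠ ∞ := by
  have h : Integrable (fun z : ℝ => |z| ^ 3) (gaussianReal 0 1) := by
    simpa using (memLp_id_gaussianReal (μ := 0) (v := 1) 3).integrable_norm_pow (p := 3)
      (by norm_num)
  rw [← ofReal_integral_eq_lintegral_ofReal h (ae_of_all _ fun z => by positivity)]
  exact ENNReal.ofReal_ne_top

/-! ### Replacing one summand by a Gaussian -/

/-- `E(N + a)_+^3 ≥ E(N + a)^3 = 3va + a^3` for `N` centred Gaussian of variance `v` and `a ≥ 0`;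
by symmetry of `N` no third moment is needed. -/
lemma ofReal_le_lintegral_posPart_cube_gaussianReal (v : ℝ≥0) {a : ℝ} (ha : 0 ≤ a) :
    ENNReal.ofReal (3 * v * a + a ^ 3) ≤
      ∫⁻ z, ENNReal.ofReal ((max 0 (z + a)) ^ 3) ∂gaussianReal 0 v := by
  have hint : Integrable (fun z : ℝ => 2 * (3 * a * z ^ 2 + a ^ 3)) (gaussianReal 0 v) :=
    (((integrable_sq_gaussianReal v).const_mul _).add (integrable_const _)).const_mul _
  have h1 : ENNReal.ofReal (2 * (3 * v * a + a ^ 3)) =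
      ∫⁻ z, ENNReal.ofReal (2 * (3 * a * z ^ 2 + a ^ 3)) ∂gaussianReal 0 v := by
    rw [← ofReal_integral_eq_lintegral_ofReal hint (ae_of_all _ fun z => by positivity),
      integral_const_mul, integral_add ((integrable_sq_gaussianReal v).const_mul _)
      (integrable_const _), integral_const_mul, integral_sq_gaussianReal]
    simp only [integral_const, probReal_univ, one_smul]
    ring_nf
  have h2 : 2 * ENNReal.ofReal (3 * v * a + a ^ 3) ≤
      2 * ∫⁻ z, ENNReal.ofReal ((max 0 (z + a)) ^ 3) ∂gaussianReal 0 v := by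
    rw [two_mul_lintegral_gaussianReal v (by fun_prop),
      ← ENNReal.ofReal_ofNat 2, ← ENNReal.ofReal_mul (by norm_num), h1]
    refine lintegral_mono fun z => ?_
    rw [← ENNReal.ofReal_add (by positivity) (by positivity)]
    refine ENNReal.ofReal_le_ofReal ?_
    have cube (u : ℝ) : u ^ 3 ≤ (max 0 u) ^ 3 :=
      Odd.pow_le_pow (by decide) |>.2 (le_max_right 0 u)
    have := cube (z + a)
    have := cube (-z + a)
    nlinarith
  exact (ENNReal.mul_le_mul_iff_right two_ne_zero ENNReal.ofNat_ne_top).1 h2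

lemma posPart_cube_add_le {a : ℝ} (ha : 0 ≤ a) (t : ℝ) :
    (max 0 (t + a)) ^ 3 ≤ (max 0 t) ^ 3 + (3 * a * t ^ 2 + 3 * a ^ 2 * t + a ^ 3) := by
  have hq : 0 ≤ a * (3 * t ^ 2 + 3 * a * t + a ^ 2) :=
    mul_nonneg ha (by nlinarith [sq_nonneg (2 * t + a), sq_nonneg t, sq_nonneg (t + a)])
  rcases le_total 0 t with ht | ht
  · rw [max_eq_right ht, max_eq_right (by linarith)]
    linarith [show (t + a) ^ 3 = t ^ 3 + (3 * a * t ^ 2 + 3 * a ^ 2 * t + a ^ 3) by ring]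
  · rw [max_eq_left ht]
    rcases le_total 0 (t + a) with h | h
    · rw [max_eq_right h]
      have : t ^ 3 ≤ 0 := Odd.pow_nonpos (by decide) ht
      linarith [show (t + a) ^ 3 = t ^ 3 + (3 * a * t ^ 2 + 3 * a ^ 2 * t + a ^ 3) by ring]
    · rw [max_eq_left h]
      linarith

/-- One replacement step: for every shift `a`, exchanging a variable of nonpositive mean for a
centred Gaussian of no smaller second moment costs at most `E T_+^3`, uniformly in `a`. -/
lemma lintegral_posPart_cube_add_le {ν : Measure ℝ} [IsProbabilityMeasure ν] {v : ℝ≥0}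
    (hv : ∫⁻ t, ENNReal.ofReal (t ^ 2) ∂ν ≤ v) (hmean : ∫ t, t ∂ν ≤ 0) (a : ℝ) :
    ∫⁻ t, ENNReal.ofReal ((max 0 (t + a)) ^ 3) ∂ν ≤
      ∫⁻ z, ENNReal.ofReal ((max 0 (z + a)) ^ 3) ∂gaussianReal 0 v +
        ∫⁻ t, ENNReal.ofReal ((max 0 t) ^ 3) ∂ν := by
  rcases le_total a 0 with ha | ha
  · refine le_add_left (lintegral_mono fun t => ENNReal.ofReal_le_ofReal ?_)
    gcongr
    linarith
  have hsq : Integrable (fun t : ℝ => t ^ 2) ν := by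
    refine ⟨by fun_prop, ?_⟩
    rw [hasFiniteIntegral_iff_ofReal (ae_of_all _ fun t => sq_nonneg t)]
    exact hv.trans_lt ENNReal.coe_lt_top
  have hid : Integrable (fun t : ℝ => t) ν :=
    ((memLp_two_iff_integrable_sq (by fun_prop)).2 hsq).integrable one_le_two
  have hv' : ∫ t, t ^ 2 ∂ν ≤ v := by
    rw [← ofReal_integral_eq_lintegral_ofReal hsq (ae_of_all _ fun t => sq_nonneg t),
      ENNReal.ofReal_le_iff_le_toReal ENNReal.coe_ne_top] at hv
    exact hv
  have hpoly : Integrable (fun t : ℝ => 3 * a * t ^ 2 + 3 * a ^ 2 * t + a ^ 3) ν :=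
    ((hsq.const_mul _).add (hid.const_mul _)).add (integrable_const _)
  have hnonneg (t : ℝ) : 0 ≤ 3 * a * t ^ 2 + 3 * a ^ 2 * t + a ^ 3 := by
    have : 0 ≤ a * (3 * t ^ 2 + 3 * a * t + a ^ 2) :=
      mul_nonneg ha (by nlinarith [sq_nonneg (2 * t + a), sq_nonneg t, sq_nonneg (t + a)])
    linarith
  calc ∫⁻ t, ENNReal.ofReal ((max 0 (t + a)) ^ 3) ∂ν
      ≤ ∫⁻ t, (ENNReal.ofReal (3 * a * t ^ 2 + 3 * a ^ 2 * t + a ^ 3) +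
          ENNReal.ofReal ((max 0 t) ^ 3)) ∂ν := by
        refine lintegral_mono fun t => ?_
        rw [← ENNReal.ofReal_add (hnonneg t) (by positivity)]
        refine ENNReal.ofReal_le_ofReal ?_
        linarith [posPart_cube_add_le ha t]
    _ = ∫⁻ t, ENNReal.ofReal (3 * a * t ^ 2 + 3 * a ^ 2 * t + a ^ 3) ∂ν +
          ∫⁻ t, ENNReal.ofReal ((max 0 t) ^ 3) ∂ν := lintegral_add_left (by fun_prop) _
    _ ≤ _ := by
        refine add_le_add_left ?_ _
        refine le_trans ?_ (ofReal_le_lintegral_posPart_cube_gaussianReal v ha)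
        rw [← ofReal_integral_eq_lintegral_ofReal hpoly (ae_of_all _ hnonneg)]
        refine ENNReal.ofReal_le_ofReal ?_
        have hlin : Integrable (fun t : ℝ => 3 * a * t ^ 2 + 3 * a ^ 2 * t) ν :=
          (hsq.const_mul _).add (hid.const_mul _)
        rw [integral_add hlin (integrable_const _), integral_add (hsq.const_mul _) (hid.const_mul _), integral_const_mul, integral_const_mul]
        simp only [integral_const, probReal_univ, one_smul]
        nlinarith [mul_le_mul_of_nonneg_left hv' ha,
          mul_nonpos_of_nonneg_of_nonpos (sq_nonneg a) hmean]

/-- Adding an independent centred Gaussian increases `E(· - x)_+^3`; this is the replacement step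
applied to the zero random variable. -/
lemma lintegral_posPart_cube_gaussianReal_mono {v w : ℝ≥0} (h : v ≤ w) (x : ℝ) :
    ∫⁻ z, ENNReal.ofReal ((max 0 (z - x)) ^ 3) ∂gaussianReal 0 v ≤
      ∫⁻ z, ENNReal.ofReal ((max 0 (z - x)) ^ 3) ∂gaussianReal 0 w := by
  obtain ⟨u, rfl⟩ := exists_add_of_le h
  rw [show gaussianReal 0 (v + u) = gaussianReal 0 v ∗ gaussianReal 0 u by
    rw [gaussianReal_conv_gaussianReal, add_zero], Measure.lintegral_conv (by fun_prop)]
  refine lintegral_mono fun z => ?_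
  have := lintegral_posPart_cube_add_le (ν := Measure.dirac 0) (v := u) (by simp) (by simp) (z - x)
  rw [lintegral_dirac' _ (by fun_prop), lintegral_dirac' _ (by fun_prop)] at this
  simp only [max_self, zero_add, ne_eq, OfNat.ofNat_ne_zero, not_false_eq_true, zero_pow,
    ENNReal.ofReal_zero, add_zero] at this
  refine this.trans_eq (lintegral_congr fun t => ?_)
  rw [add_sub_assoc', add_comm t z]

/-- All summands replaced, by induction on their number. -/
lemma lintegral_posPart_cube_sum_le {Ω : Type*} [MeasurableSpace Ω] {P : Measure Ω}
    [IsProbabilityMeasure P] {n : ℕ} {X : Fin n → Ω → ℝ} (hm : ∀ i, Measurable (X i))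
    (hX : iIndepFun X P) (hmean : ∀ i, ∫ ω, X i ω ∂P ≤ 0) (v : Fin n → ℝ≥0)
    (hv : ∀ i, expNN P (fun ω => X i ω ^ 2) ≤ v i) (x : ℝ) :
    expNN P (fun ω => (max 0 ((∑ i, X i ω) - x)) ^ 3) ≤
      expNN (gaussianReal 0 (∑ i, v i)) (fun z => (max 0 (z - x)) ^ 3) +
        ∑ i, expNN P (fun ω => (max 0 (X i ω)) ^ 3) := by
  induction n generalizing x with
  | zero => simp [expNN, gaussianReal_zero_var]
  | succ n ih =>
    have hS : Measurable fun ω => ∑ i : Fin n, X i.castSucc ω :=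
      Finset.measurable_fun_sum _ fun i _ => hm _
    have hS' : Measurable fun ω => ∑ i, X i ω := Finset.measurable_fun_sum _ fun i _ => hm _
    have hIH := ih (fun i => hm i.castSucc) (hX.precomp (Fin.castSucc_injective n))
      (fun i => hmean _) (fun i => v i.castSucc) (fun i => hv _)
    set μ := P.map (fun ω => ∑ i : Fin n, X i.castSucc ω) with hμ
    set ν := P.map (X (Fin.last n)) with hν
    set V := ∑ i : Fin n, v i.castSucc
    set w := v (Fin.last n)
    set β := ∑ i : Fin n, expNN P (fun ω => (max 0 (X i.castSucc ω)) ^ 3)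
    have : IsProbabilityMeasure μ := Measure.isProbabilityMeasure_map hS.aemeasurable
    have : IsProbabilityMeasure ν := Measure.isProbabilityMeasure_map (hm _).aemeasurable
    have hβ : expNN P (fun ω => (max 0 (X (Fin.last n) ω)) ^ 3) =
        ∫⁻ t, ENNReal.ofReal ((max 0 t) ^ 3) ∂ν := by
      rw [hν, lintegral_map (by fun_prop) (hm _), expNN]
    have hstep : ∀ s, ∫⁻ t, ENNReal.ofReal ((max 0 (t + s)) ^ 3) ∂ν ≤
        ∫⁻ z, ENNReal.ofReal ((max 0 (z + s)) ^ 3) ∂gaussianReal 0 w +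
          ∫⁻ t, ENNReal.ofReal ((max 0 t) ^ 3) ∂ν := by
      refine lintegral_posPart_cube_add_le ?_ ?_
      · rw [hν, lintegral_map (by fun_prop) (hm _)]
        exact hv _
      · rw [hν, integral_map (hm _).aemeasurable (by fun_prop)]
        exact hmean _
    have hIH' (y : ℝ) : ∫⁻ s, ENNReal.ofReal ((max 0 (s - y)) ^ 3) ∂μ ≤
        ∫⁻ z, ENNReal.ofReal ((max 0 (z - y)) ^ 3) ∂gaussianReal 0 V + β := by
      rw [hμ, lintegral_map (by fun_prop) hS]
      exact hIH y
    have hconv : gaussianReal 0 (∑ i, v i) = gaussianReal 0 V ∗ gaussianReal 0 w := by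
      rw [gaussianReal_conv_gaussianReal, add_zero, Fin.sum_univ_castSucc]
    rw [Fin.sum_univ_castSucc (f := fun i => expNN P (fun ω => (max 0 (X i ω)) ^ 3)), hβ, hconv,
      show expNN P (fun ω => (max 0 ((∑ i, X i ω) - x)) ^ 3) =
        ∫⁻ u, ENNReal.ofReal ((max 0 (u - x)) ^ 3) ∂(μ ∗ ν) by
          rw [hμ, hν, ← map_sum_univ_succ_eq_conv hm hX, lintegral_map (by fun_prop) hS', expNN],
      expNN, Measure.lintegral_conv (by fun_prop), Measure.lintegral_conv (by fun_prop)]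
    calc ∫⁻ s, ∫⁻ t, ENNReal.ofReal ((max 0 (s + t - x)) ^ 3) ∂ν ∂μ
        = ∫⁻ t, ∫⁻ s, ENNReal.ofReal ((max 0 (s - (x - t))) ^ 3) ∂μ ∂ν := by
          rw [lintegral_lintegral_swap (by fun_prop)]
          simp only [sub_sub_eq_add_sub]
      _ ≤ ∫⁻ t, (∫⁻ z, ENNReal.ofReal ((max 0 (z - (x - t))) ^ 3) ∂gaussianReal 0 V + β) ∂ν :=
          lintegral_mono fun t => hIH' _
      _ = ∫⁻ z, ∫⁻ t, ENNReal.ofReal ((max 0 (t + (z - x))) ^ 3) ∂ν ∂gaussianReal 0 V + β := by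
          rw [lintegral_add_right _ measurable_const, lintegral_const, measure_univ, mul_one,
            lintegral_lintegral_swap (by fun_prop)]
          congr! 8
          ring
      _ ≤ ∫⁻ z, (∫⁻ t, ENNReal.ofReal ((max 0 (t + (z - x))) ^ 3) ∂gaussianReal 0 w +
            ∫⁻ t, ENNReal.ofReal ((max 0 t) ^ 3) ∂ν) ∂gaussianReal 0 V + β := by
          gcongr with z
          exact hstep _
      _ = _ := by
          rw [lintegral_add_right _ measurable_const, lintegral_const, measure_univ, mul_one,
            add_assoc, add_comm β]
          congr! 8
          ring

/-! ### Upper bounds -/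

theorem expNN_posPart_cube_sum_sub_le {Ω : Type*} [MeasurableSpace Ω] {P : Measure Ω}
    [IsProbabilityMeasure P] {n : ℕ} {X : Fin n → Ω → ℝ} (hX : IndepUnitVariance P X)
    (hmean : ∀ i, ∫ ω, X i ω ∂P ≤ 0) (x : ℝ) :
    expNN P (fun ω => (max 0 ((∑ i, X i ω) - x)) ^ 3) ≤
      expNN (gaussianReal 0 1) (fun z => (max 0 (z - x)) ^ 3) +
        ∑ i, expNN P (fun ω => (max 0 (X i ω)) ^ 3) := by
  have hfin (i) : expNN P (fun ω => X i ω ^ 2) ≠ ∞ :=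
    ne_top_of_le_ne_top ENNReal.one_ne_top
      ((Finset.single_le_sum (fun _ _ => zero_le) (Finset.mem_univ i)).trans hX.sum_sq_le)
  have hV : ∑ i, (expNN P (fun ω => X i ω ^ 2)).toNNReal ≤ 1 := by
    rw [← ENNReal.coe_le_coe, ENNReal.ofNNReal_finsetSum]
    simpa [ENNReal.coe_toNNReal (hfin _)] using hX.sum_sq_le
  refine (lintegral_posPart_cube_sum_le hX.measurable hX.indep hmean _
    (fun i => (ENNReal.coe_toNNReal (hfin i)).ge) x).trans ?_
  gcongr
  exact lintegral_posPart_cube_gaussianReal_mono hV x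

lemma ofReal_abs_cube (u : ℝ) : ENNReal.ofReal (|u| ^ 3) =
    ENNReal.ofReal ((max 0 u) ^ 3) + ENNReal.ofReal ((max 0 (-u)) ^ 3) := by
  rcases le_total 0 u with h | h
  · simp [abs_of_nonneg h, h]
  · simp [abs_of_nonpos h, h]

lemma expNN_abs_cube {Ω : Type*} [MeasurableSpace Ω] (P : Measure Ω) {Y : Ω → ℝ}
    (hY : Measurable Y) : expNN P (fun ω => |Y ω| ^ 3) =
      expNN P (fun ω => (max 0 (Y ω)) ^ 3) + expNN P (fun ω => (max 0 (-Y ω)) ^ 3) := by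
  simp only [expNN, ofReal_abs_cube]
  exact lintegral_add_left (by fun_prop) _

theorem expNN_abs_cube_sum_sub_le {Ω : Type*} [MeasurableSpace Ω] {P : Measure Ω}
    [IsProbabilityMeasure P] {n : ℕ} {X : Fin n → Ω → ℝ} (hX : IndepUnitVariance P X)
    (hmean : ∀ i, ∫ ω, X i ω ∂P = 0) (x : ℝ) :
    expNN P (fun ω => |(∑ i, X i ω) - x| ^ 3) ≤
      expNN (gaussianReal 0 1) (fun z => |z - x| ^ 3) + ∑ i, expNN P (fun ω => |X i ω| ^ 3) := by
  have hX' : IndepUnitVariance P (fun i ω => -X i ω) :=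
    ⟨fun i => (hX.measurable i).neg, hX.indep.comp (fun _ t => -t) fun _ => measurable_neg,
      by simpa using hX.sum_sq_le⟩
  have h1 := expNN_posPart_cube_sum_sub_le hX (fun i => (hmean i).le) x
  have h2 := expNN_posPart_cube_sum_sub_le hX' (fun i => by simp [integral_neg, hmean i]) (-x)
  have hg : expNN (gaussianReal 0 1) (fun z => (max 0 (z - -x)) ^ 3) =
      expNN (gaussianReal 0 1) (fun z => (max 0 (-(z - x))) ^ 3) := by
    unfold expNN
    rw [← lintegral_gaussianReal_neg 1 (f := fun z => ENNReal.ofReal ((max 0 (z - -x)) ^ 3))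
      (by fun_prop)]
    simp only [neg_sub_neg, neg_sub]
  have hS : (fun ω => (max 0 ((∑ i, -X i ω) - -x)) ^ 3) =
      fun ω => (max 0 (-((∑ i, X i ω) - x))) ^ 3 := by
    ext ω
    rw [Finset.sum_neg_distrib]
    congr 2
    ring
  have hm := hX.measurable
  rw [expNN_abs_cube P (by fun_prop), expNN_abs_cube _ (by fun_prop)]
  simp only [expNN_abs_cube P (hm _), Finset.sum_add_distrib]
  rw [hg, hS] at h2
  exact (add_le_add h1 h2).trans_eq (add_add_add_comm _ _ _ _)

/-! ### Convexity of the cubed absolute value -/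

lemma abs_cube_add_le (a x : ℝ) {s : ℝ} (hs0 : 0 ≤ s) (hs1 : s ≤ 1) :
    |a - s * x| ^ 3 + |a + s * x| ^ 3 ≤ |a - x| ^ 3 + |a + x| ^ 3 := by
  have hc : ConvexOn ℝ Set.univ (fun u : ℝ => |u| ^ 3) :=
    (convexOn_univ_norm (E := ℝ)).pow (fun u _ => norm_nonneg u) 3
  have h1 := hc.2 (Set.mem_univ (a - x)) (Set.mem_univ (a + x))
    (show 0 ≤ (1 + s) / 2 by linarith) (show 0 ≤ (1 - s) / 2 by linarith) (by ring)
  have h2 := hc.2 (Set.mem_univ (a - x)) (Set.mem_univ (a + x))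
    (show 0 ≤ (1 - s) / 2 by linarith) (show 0 ≤ (1 + s) / 2 by linarith) (by ring)
  simp only [smul_eq_mul] at h1 h2
  rw [show (1 + s) / 2 * (a - x) + (1 - s) / 2 * (a + x) = a - s * x by ring] at h1
  rw [show (1 - s) / 2 * (a - x) + (1 + s) / 2 * (a + x) = a + s * x by ring] at h2
  linarith

/-- Shrinking a standard Gaussian by a factor `s ≤ 1` costs at most the factor `s^3` in
`E|· - x|^3`. -/
lemma mul_lintegral_abs_cube_gaussianReal_le {s : ℝ≥0} (hs : s ≤ 1) (x : ℝ) :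
    ENNReal.ofReal ((s : ℝ) ^ 3) * ∫⁻ z, ENNReal.ofReal (|z - x| ^ 3) ∂gaussianReal 0 1 ≤
      ∫⁻ z, ENNReal.ofReal (|z - x| ^ 3) ∂gaussianReal 0 (s ^ 2) := by
  rw [lintegral_gaussianReal_sq s (by fun_prop)]
  refine (ENNReal.mul_le_mul_iff_right two_ne_zero ENNReal.ofNat_ne_top).1 ?_
  rw [mul_left_comm, two_mul_lintegral_gaussianReal 1 (by fun_prop),
    two_mul_lintegral_gaussianReal 1 (f := fun z => ENNReal.ofReal (|s * z - x| ^ 3)) (by fun_prop),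
    ← lintegral_const_mul _ (by fun_prop)]
  refine lintegral_mono fun z => ?_
  rw [← ENNReal.ofReal_add (by positivity) (by positivity), ← ENNReal.ofReal_mul (by positivity),
    ← ENNReal.ofReal_add (by positivity) (by positivity)]
  refine ENNReal.ofReal_le_ofReal ?_
  have h := abs_cube_add_le (s * z) x s.coe_nonneg (by exact_mod_cast hs)
  have hs3 (u : ℝ) : |s * u| ^ 3 = s ^ 3 * |u| ^ 3 := by
    rw [abs_mul, mul_pow, abs_of_nonneg s.coe_nonneg]
  have e1 : |-z - x| = |z + x| := by rw [← abs_neg]; ring_nf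
  have e2 : |s * -z - x| = |s * z + x| := by rw [← abs_neg]; ring_nf
  rw [e1, e2, mul_add, ← hs3, ← hs3, mul_sub, mul_add]
  exact h

/-! ### Summands for the lower bound -/

lemma map_sum_eq_gaussianReal {Ω : Type*} [MeasurableSpace Ω] {P : Measure Ω}
    [IsProbabilityMeasure P] {n : ℕ} {X : Fin n → Ω → ℝ} (hm : ∀ i, Measurable (X i))
    (hX : iIndepFun X P) {v : ℝ≥0} (hv : ∀ i, P.map (X i) = gaussianReal 0 v) :
    P.map (fun ω => ∑ i, X i ω) = gaussianReal 0 (n * v) := by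
  induction n with
  | zero => simp [gaussianReal_zero_var, Measure.map_const]
  | succ n ih =>
    rw [map_sum_univ_succ_eq_conv hm hX, hv, ih (fun i => hm i.castSucc)
      (hX.precomp (Fin.castSucc_injective n)) (fun i => hv _), gaussianReal_conv_gaussianReal]
    congr 1
    · simp
    · push_cast; ring

/-- The law on `{-y, 0, y}` giving mass `q / 2` to each of `y` and `-y`, for `0 ≤ q ≤ 1`. -/
noncomputable def symmJump (q y : ℝ) : Measure ℝ :=
  ENNReal.ofReal (1 - q) • Measure.dirac 0 +
    ENNReal.ofReal (q / 2) • (Measure.dirac y + Measure.dirac (-y))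

lemma lintegral_symmJump (q y : ℝ) {f : ℝ → ℝ≥0∞} (hf : Measurable f) :
    ∫⁻ t, f t ∂symmJump q y =
      ENNReal.ofReal (1 - q) * f 0 + ENNReal.ofReal (q / 2) * (f y + f (-y)) := by
  simp [symmJump, lintegral_add_measure, lintegral_smul_measure, lintegral_dirac' _ hf, mul_add]

lemma isProbabilityMeasure_symmJump {q : ℝ} (hq0 : 0 ≤ q) (hq1 : q ≤ 1) (y : ℝ) :
    IsProbabilityMeasure (symmJump q y) := by
  constructor
  rw [← lintegral_one, lintegral_symmJump q y measurable_const, mul_one, one_add_one_eq_two,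
    ← ENNReal.ofReal_ofNat 2, ← ENNReal.ofReal_mul (by positivity),
    ← ENNReal.ofReal_add (by linarith) (by positivity), ← ENNReal.ofReal_one]
  ring_nf

lemma integral_symmJump (q y : ℝ) : ∫ t, t ∂symmJump q y = 0 := by
  have h (c : ℝ) : Integrable (fun t : ℝ => t) (Measure.dirac c) :=
    (integrable_dirac (by simp))
  rw [symmJump, integral_add_measure ((h 0).smul_measure ENNReal.ofReal_ne_top)
    (((h y).add_measure (h (-y))).smul_measure ENNReal.ofReal_ne_top), integral_smul_measure,
    integral_smul_measure, integral_add_measure (h y) (h (-y))]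
  simp

lemma lintegral_symmJump_even {q : ℝ} (hq0 : 0 ≤ q) (y : ℝ) {f : ℝ → ℝ}
    (hf : Measurable f) (hf0 : f 0 = 0) (hpos : 0 ≤ f y) (heven : f (-y) = f y) :
    ∫⁻ t, ENNReal.ofReal (f t) ∂symmJump q y = ENNReal.ofReal (q * f y) := by
  rw [lintegral_symmJump q y (by fun_prop), hf0, heven, ENNReal.ofReal_zero, mul_zero,
    zero_add, ← ENNReal.ofReal_add hpos hpos, ← ENNReal.ofReal_mul (by positivity)]
  ring_nf

lemma le_lintegral_abs_cube_symmJump {q y : ℝ} (hq0 : 0 ≤ q) (hy : 0 ≤ y) (a : ℝ) :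
    ENNReal.ofReal (1 - q) * ENNReal.ofReal (|a| ^ 3) + ENNReal.ofReal (q * y ^ 3) ≤
      ∫⁻ t, ENNReal.ofReal (|a + t| ^ 3) ∂symmJump q y := by
  rw [lintegral_symmJump q y (by fun_prop), add_zero]
  refine add_le_add_right ?_ _
  rw [← ENNReal.ofReal_add (by positivity) (by positivity), ← ENNReal.ofReal_mul (by positivity)]
  refine ENNReal.ofReal_le_ofReal ?_
  have h := abs_cube_add_le y a le_rfl zero_le_one
  rw [zero_mul, sub_zero, add_zero, abs_of_nonneg hy, abs_sub_comm y a, add_comm y a] at h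
  rw [← sub_eq_add_neg]
  nlinarith [mul_le_mul_of_nonneg_left h hq0]

/-- `k^2` Gaussian summands of standard deviation `σ` and one symmetric jump of size `y` and
probability `q`. The cubed jump enters `E|S - x|^3` at full weight, whatever the Gaussian part. -/
lemma exists_mem_absThirdMomentValues_ge {x B q y : ℝ} {σ : ℝ≥0} {k : ℕ} (hq0 : 0 ≤ q)
    (hq1 : q ≤ 1) (hy : 0 ≤ y) (hσ : k * σ ≤ 1) (hvar : (k * σ : ℝ) ^ 2 + q * y ^ 2 ≤ 1)
    (hB : (k : ℝ) ^ 2 * (σ ^ 3 * (expNN (gaussianReal 0 1) (fun z => |z| ^ 3)).toReal) +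
      q * y ^ 3 = B) :
    ∃ m ∈ absThirdMomentValues x B,
      ENNReal.ofReal ((1 - q) * (k * σ) ^ 3) * expNN (gaussianReal 0 1) (fun z => |z - x| ^ 3) +
        ENNReal.ofReal (q * y ^ 3) ≤ m := by
  let ν : Fin (k ^ 2 + 1) → Measure ℝ :=
    Fin.snoc (α := fun _ => Measure ℝ) (fun _ => gaussianReal 0 (σ ^ 2)) (symmJump q y)
  have hνc (i : Fin (k ^ 2)) : ν i.castSucc = gaussianReal 0 (σ ^ 2) := by simp [ν]
  have hνl : ν (Fin.last _) = symmJump q y := by simp [ν]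
  have hjump := isProbabilityMeasure_symmJump hq0 hq1 y
  have hν (i) : IsProbabilityMeasure (ν i) := by
    induction i using Fin.lastCases with
    | last => rw [hνl]; exact hjump
    | cast i => rw [hνc]; infer_instance
  let X : Fin (k ^ 2 + 1) → (Fin (k ^ 2 + 1) → ℝ) → ℝ := fun i ω => ω i
  have hm (i) : Measurable (X i) := measurable_pi_apply i
  have hlaw (i) : (Measure.pi ν).map (X i) = ν i := (measurePreserving_eval ν i).map_eq
  have hind : iIndepFun X (Measure.pi ν) :=
    iIndepFun_pi (X := fun _ t => t) fun _ => aemeasurable_id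
  have hexp (i) {f : ℝ → ℝ} (hf : Measurable f) :
      expNN (Measure.pi ν) (fun ω => f (X i ω)) = ∫⁻ t, ENNReal.ofReal (f t) ∂ν i := by
    rw [← hlaw, lintegral_map (by fun_prop) (hm i), expNN]
  refine ⟨_, ⟨_, _, _, Measure.pi ν, inferInstance, X, ⟨hm, hind, ?_⟩, fun i => ?_, ?_, rfl⟩, ?_⟩
  · simp only [hexp _ (f := fun t => t ^ 2) (by fun_prop)]
    rw [Fin.sum_univ_castSucc, hνl, lintegral_symmJump_even hq0 y (by fun_prop) (by simp)
      (by positivity) (by simp)]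
    simp only [hνc, lintegral_sq_gaussianReal, Finset.sum_const, Finset.card_univ, Fintype.card_fin,
      nsmul_eq_mul]
    rw [← ENNReal.ofReal_coe_nnreal, ← ENNReal.ofReal_natCast, ← ENNReal.ofReal_mul (by positivity),
      ← ENNReal.ofReal_add (by positivity) (by positivity), ← ENNReal.ofReal_one]
    refine ENNReal.ofReal_le_ofReal ?_
    push_cast
    linarith
  · have h : ∫ ω, X i ω ∂Measure.pi ν = ∫ t, t ∂ν i := by
      rw [← hlaw i, integral_map (hm i).aemeasurable (by fun_prop)]
    rw [h]
    induction i using Fin.lastCases with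
    | last => rw [hνl, integral_symmJump]
    | cast i => rw [hνc, integral_id_gaussianReal]
  · simp only [hexp _ (f := fun t => |t| ^ 3) (by fun_prop)]
    rw [Fin.sum_univ_castSucc, hνl, lintegral_symmJump_even hq0 y (by fun_prop) (by simp)
      (by positivity) (by simp)]
    have hg : ∫⁻ t, ENNReal.ofReal (|t| ^ 3) ∂gaussianReal 0 (σ ^ 2) =
        ENNReal.ofReal (σ ^ 3 * (expNN (gaussianReal 0 1) (fun z => |z| ^ 3)).toReal) := by
      rw [lintegral_gaussianReal_sq σ (by fun_prop), ENNReal.ofReal_mul (by positivity),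
        expNN, ENNReal.ofReal_toReal lintegral_abs_pow_three_gaussianReal_ne_top,
        ← lintegral_const_mul _ (by fun_prop)]
      refine lintegral_congr fun t => ?_
      rw [← ENNReal.ofReal_mul (by positivity), abs_mul, mul_pow, NNReal.abs_eq]
    simp only [hνc, hg, Finset.sum_const, Finset.card_univ, Fintype.card_fin, nsmul_eq_mul]
    rw [← ENNReal.ofReal_natCast, ← ENNReal.ofReal_mul (by positivity),
      ← ENNReal.ofReal_add (by positivity) (by positivity), ← hB, abs_of_nonneg hy]
    push_cast
    rfl
  · have hS : Measurable fun ω => ∑ i, X i ω := Finset.measurable_fun_sum _ fun i _ => hm i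
    have hSlaw : (Measure.pi ν).map (fun ω => ∑ i, X i ω) =
        gaussianReal 0 ((k * σ) ^ 2) ∗ symmJump q y := by
      rw [map_sum_univ_succ_eq_conv hm hind, hlaw, hνl, map_sum_eq_gaussianReal
        (fun i => hm i.castSucc) (hind.precomp (Fin.castSucc_injective _)) fun i => by
          rw [hlaw, hνc]]
      congr 2
      push_cast; ring
    rw [show expNN (Measure.pi ν) (fun ω => |(∑ i, X i ω) - x| ^ 3) =
      ∫⁻ u, ENNReal.ofReal (|u - x| ^ 3) ∂(gaussianReal 0 ((k * σ) ^ 2) ∗ symmJump q y) by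
        rw [← hSlaw, lintegral_map (by fun_prop) hS, expNN], Measure.lintegral_conv (by fun_prop)]
    have hshrink := mul_lintegral_abs_cube_gaussianReal_le hσ x
    push_cast at hshrink
    calc _ ≤ ENNReal.ofReal (1 - q) *
            ∫⁻ z, ENNReal.ofReal (|z - x| ^ 3) ∂gaussianReal 0 ((k * σ) ^ 2) +
              ENNReal.ofReal (q * y ^ 3) := by
          rw [ENNReal.ofReal_mul (by linarith), mul_assoc]
          gcongr
          exact hshrink
      _ = ∫⁻ z, (ENNReal.ofReal (1 - q) * ENNReal.ofReal (|z - x| ^ 3) +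
            ENNReal.ofReal (q * y ^ 3)) ∂gaussianReal 0 ((k * σ) ^ 2) := by
          rw [lintegral_add_right _ measurable_const, lintegral_const, measure_univ, mul_one,
            lintegral_const_mul _ (by fun_prop)]
      _ ≤ _ := by
          refine lintegral_mono fun z => ?_
          simpa only [sub_add_eq_add_sub] using le_lintegral_abs_cube_symmJump hq0 hy (z - x)

/-! ### Exactness -/

theorem isLUB_absThirdMomentValues (x : ℝ) {B : ℝ} (hB : 0 < B) :
    IsLUB (absThirdMomentValues x B)
      (expNN (gaussianReal 0 1) (fun z => |z - x| ^ 3) + ENNReal.ofReal B) := by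
  refine ⟨?_, fun u hu => ?_⟩
  · rintro _ ⟨n, Ω, _, P, _, X, hX, hmean, h3, rfl⟩
    rw [← h3]
    exact expNN_abs_cube_sum_sub_le hX hmean x
  set A := expNN (gaussianReal 0 1) (fun z => |z - x| ^ 3)
  set c := (expNN (gaussianReal 0 1) (fun z => |z| ^ 3)).toReal with hc
  -- The jump has size `k` and probability `b k / k ^ 3`, the Gaussian summands have standard
  -- deviation `s k / k`, and `b k` is what their third moments leave of `B`.
  let s : ℕ → ℝ := fun k => 1 - B / k
  let b : ℕ → ℝ := fun k => B - s k ^ 3 * c / k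
  let q : ℕ → ℝ := fun k => b k / (k : ℝ) ^ 3
  have hk := tendsto_natCast_atTop_atTop (R := ℝ)
  have hs : Tendsto s atTop (𝓝 1) := by
    simpa using tendsto_const_nhds.sub (hk.const_div_atTop B)
  have hb : Tendsto b atTop (𝓝 B) := by
    simpa using tendsto_const_nhds.sub (((hs.pow 3).mul_const c).div_atTop hk)
  have hq : Tendsto q atTop (𝓝 0) :=
    hb.div_atTop ((tendsto_pow_atTop three_ne_zero).comp hk)
  have hlim : Tendsto (fun k => ENNReal.ofReal ((1 - q k) * s k ^ 3) * A + ENNReal.ofReal (b k))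
      atTop (𝓝 (A + ENNReal.ofReal B)) := by
    have h1 : Tendsto (fun k => (1 - q k) * s k ^ 3) atTop (𝓝 1) := by
      simpa using (tendsto_const_nhds.sub hq).mul (hs.pow 3)
    simpa using (ENNReal.Tendsto.mul_const (ENNReal.tendsto_ofReal h1) (Or.inl (by simp))).add
      (ENNReal.tendsto_ofReal hb)
  refine le_of_tendsto hlim ?_
  filter_upwards [eventually_gt_atTop 0, hk.eventually_ge_atTop B, hb.eventually_const_lt hB,
    hq.eventually_lt_const zero_lt_one] with k hk0 hkB hbk hqk
  have hk0' : (0 : ℝ) < k := by exact_mod_cast hk0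
  have ht1 : B / k ≤ 1 := (div_le_one hk0').2 hkB
  have ht0 : 0 ≤ B / k := by positivity
  have hs0 : 0 ≤ s k := sub_nonneg.2 ht1
  have hc0 : 0 ≤ c := ENNReal.toReal_nonneg
  have hbB : b k ≤ B := sub_le_self _ (by positivity)
  have hq3 : q k * (k : ℝ) ^ 3 = b k := div_mul_cancel₀ _ (by positivity)
  have hσ : (k : ℝ) * ((s k / k).toNNReal : ℝ) = s k := by
    rw [Real.coe_toNNReal _ (by positivity)]
    field_simp
  obtain ⟨m, hm, hle⟩ := exists_mem_absThirdMomentValues_ge (x := x) (B := B) (q := q k) (y := k)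
    (σ := (s k / k).toNNReal) (k := k) (by positivity) hqk.le hk0'.le
    (by rw [← NNReal.coe_le_coe]; push_cast; rw [hσ]; exact sub_le_self _ ht0)
    (by
      have h2 : q k * (k : ℝ) ^ 2 = b k / k := by simp only [q]; field_simp
      have h3 : b k / k ≤ B / k := by gcongr
      rw [hσ, h2]
      have : s k = 1 - B / k := rfl
      nlinarith)
    (by
      rw [hq3, Real.coe_toNNReal _ (by positivity), ← hc]
      simp only [b]
      field_simp
      ring)
  rw [hσ, hq3] at hle
  exact hle.trans (hu hm)

theorem mainTheorem2 :
    (∀ (n : ℕ) (Ω : Type*) [MeasurableSpace Ω] (P : Measure Ω) [IsProbabilityMeasure P]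
      (X : Fin n → Ω → ℝ), IndepUnitVariance P X →
      (∀ β : ℝ, 0 < β → (∀ i, ∫ ω, X i ω ∂P ≤ 0) →
        ∑ i, expNN P (fun ω => (max 0 (X i ω)) ^ 3) ≤ ENNReal.ofReal β →
        ∀ x : ℝ, expNN P (fun ω => (max 0 ((∑ i, X i ω) - x)) ^ 3) ≤
          expNN (gaussianReal 0 1) (fun z => (max 0 (z - x)) ^ 3) + ENNReal.ofReal β) ∧
      ((∀ i, ∫ ω, X i ω ∂P = 0) →
        ∀ x : ℝ, expNN P (fun ω => |(∑ i, X i ω) - x| ^ 3) ≤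
          expNN (gaussianReal 0 1) (fun z => |z - x| ^ 3) +
            ∑ i, expNN P (fun ω => |X i ω| ^ 3))) ∧
    (∀ x B : ℝ, 0 < B →
      IsLUB (absThirdMomentValues x B)
        (expNN (gaussianReal 0 1) (fun z => |z - x| ^ 3) + ENNReal.ofReal B)) := by
  refine ⟨fun n Ω _ P _ X hX => ⟨fun β _ hmean hβ x => ?_, expNN_abs_cube_sum_sub_le hX⟩,
    fun x B hB => isLUB_absThirdMomentValues x hB⟩
  exact (expNN_posPart_cube_sum_sub_le hX hmean x).trans (add_le_add_right hβ _)
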